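/- Let $Y$ be a metric space with its Borel $\sigma$-algebra. A general Markov decision process (gMDP) over $Y$ is $M=(X,\pi,T,A,h)$ with Polish state and control spaces $X$, $A$, an initial probability measure $\pi$ on $X$, a Borel stochastic kernel $T(\cdot\mid x,u)$ on $X$ given $X\times A$, and a Borel output map $h:X\to Y$; for a probability measure $m$ on $A$ put $T(\cdot\mid x,m)=\int_A T(\cdot\mid x,u)\,m(du)$. A Markov policy for $M$ is a sequence $\mu=(\mu_0,\mu_1,\dots)$ of universally measurable maps $\mu_t:X\to\mathcal P(A)$. A control strategy $C$ for $M$ consists of a Polish space $X_C$, an initial internal state $x_{C0}\in X_C$, a universally measurable stochastic kernel $T_C$ on $X_C$ given $X_C\times X$, and a universally measurable map $h_C:X_C\to\mathcal P(A)$; the controlled process is $x_C(0)=x_{C0}$, $x(0)\sim\pi$, and, for $t\ge 0$, $x_C(t+1)\sim T_C(\cdot\mid x_C(t),x(t))$, $u(t)\sim h_C(x_C(t+1))$, $x(t+1)\sim T(\cdot\mid x(t),u(t))$. Write $\mathbb P_{C\times M}$ for its law, $\Diamond^{\le N}K$ for the event that $h(x(t))\in K$ for some $0\le t\le N$, and $\Diamond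 K$ for the event that $h(x(t))\in K$ for some $t\ge 0$. Let $M_1,M_2$ be gMDPs over $Y$ and $\varepsilon,\delta\ge 0$. Write $M_1\preceq^\delta_\varepsilon M_2$ if there are a Borel stochastic kernel $\mathcal U$ on $A_2$ given $A_1\times X_1\times X_2$, a Borel set $R\subseteq X_1\times X_2$, and a Borel stochastic kernel $W$ on $X_1\times X_2$ given $A_1\times X_1\times X_2$ such that: (i) $d(h_1(x_1),h_2(x_2))\le\varepsilon$ for all $(x_1,x_2)\in R$; (ii) for all $(x_1,x_2)\in R$ and $u_1\in A_1$, the measure $W(\cdot\mid u_1,x_1,x_2)$ has marginals $T_1(\cdot\mid x_1,u_1)$ and $T_2(\cdot\mid x_2,\mathcal U(u_1,x_1,x_2))$ and gives $R$ mass at least $1-\delta$; (iii) some probability measure on $X_1\times X_2$ has marginals $\pi_1,\pi_2$ and gives $R$ mass at least $1-\delta$. A Markov policy $\mu$ for $M_1$ is said to $(\varepsilon,\delta)$-robustly reach $K$ within $N$ steps (respectively, to $(\varepsilon,\delta)$-robustly reach $K$) with probability $p$ if every gMDP $M_2$ over $Y$ with $M_1\preceq^\delta_\varepsilon M_2$ has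 a control strategy $C_2$ with $\mathbb P_{C_2\times M_2}(\Diamond^{\le N}K)\ge p$ (respectively $\mathbb P_{C_2\times M_2}(\Diamond K)\ge p$). Let $L(z)=\min(1,\max(0,z))$. For a Borel set $G\subseteq X_1$, a universally measurable $\nu:X_1\to\mathcal P(A_1)$ and $V:X_1\to[0,1]$, let $$(\mathbf T^\nu_\delta V)(x)=L\Big(\int_{X_1}\big[\mathbf 1_G(\bar x)+\mathbf 1_{X_1\setminus G}(\bar x)V(\bar x)\big]\,T_1(d\bar x\mid x,\nu(x))-\delta\Big).$$ For a Markov policy $\mu$ for $M_1$ and $N\in\mathbb N$ put $V_N=0$, $V_k=\mathbf T^{\mu_k}_\delta V_{k+1}$ for $k=N-1,\dots,0$, and $$r^\mu(G,N)=L\Big(\int_{X_1}[\mathbf 1_G+\mathbf 1_{X_1\setminus G}V_0]\,d\pi_1-\delta\Big).$$ If $\mu=(\nu,\nu,\dots)$ is time-homogeneous, let $V_\infty$ be the pointwise limit of $(\mathbf T^\nu_\delta)^q(0)$ as $q\to\infty$, and put $r^\mu(G)=L\big(\int_{X_1}[\mathbf 1_G+\mathbf 1_{X_1\setminus G}V_\infty]\,d\pi_1-\delta\big)$.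 Let $\varepsilon,\delta\ge0$, let $K\subseteq Y$ be Borel, and let $K^\varepsilon$ be a Borel subset of $\{y\in Y:\ \bar y\in K\text{ for all }\bar y\in Y\text{ with }d(\bar y,y)\le\varepsilon\}$ (in particular the largest one, when it exists). Put $K^\varepsilon_{X_1}=h_1^{-1}(K^\varepsilon)$, and let $\mu$ be a Markov policy for $M_1$. Then: 1. for every $N\in\mathbb N$, $\mu$ $(\varepsilon,\delta)$-robustly reaches $K$ within $N$ steps with probability $r^\mu(K^\varepsilon_{X_1},N)$; 2. if $\mu=(\nu,\nu,\dots)$ is time-homogeneous, then, for $G=K^\varepsilon_{X_1}$, the limit $V_\infty$ exists at every point and satisfies $\mathbf T^\nu_\delta V_\infty=V_\infty$, and $\mu$ $(\varepsilon,\delta)$-robustly reaches $K$ with probability $r^\mu(K^\varepsilon_{X_1})$. -/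

import Mathlib

open MeasureTheory ProbabilityTheory Filter Topology

universe u v

noncomputable section

/-! ### Universal measurability -/

/-- The type `α`, to be equipped with the σ-algebra of universally measurable sets. -/
def UM (α : Type*) : Type _ := α

namespace UM

/-- The identity map from `α` with universally measurable sets to `α` with its own σ-algebra. -/
def get {α : Type*} (x : UM α) : α := x

/-- The identity map from `α` to `α` with universally measurable sets. -/
def mk {α : Type*} (x : α) : UM α := x

/-- The σ-algebra of universally measurable sets: the sets that are measurable for the completion
of every probability measure. -/
instance instMeasurableSpace {α : Type*} [MeasurableSpace α] : MeasurableSpace (UM α) where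
  MeasurableSet' s := ∀ p : Measure α, IsProbabilityMeasure p → NullMeasurableSet (get ⁻¹' s : Set α) p
  measurableSet_empty _ _ := MeasurableSet.empty.nullMeasurableSet
  measurableSet_compl _ hs p hp := (hs p hp).compl
  measurableSet_iUnion _ hs p hp := NullMeasurableSet.iUnion fun i => hs i p hp

theorem measurableSet_iff {α : Type*} [MeasurableSpace α] {s : Set (UM α)} :
    MeasurableSet s ↔
      ∀ p : Measure α, IsProbabilityMeasure p → NullMeasurableSet (mk ⁻¹' s : Set α) p :=
  Iff.rfl

theorem measurable_get {α : Type*} [MeasurableSpace α] : Measurable (get : UM α → α) :=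
  fun _ hs _ _ => hs.nullMeasurableSet

/-- The (unique) extension of a probability measure to the universally measurable sets. -/
def extend {α : Type*} [MeasurableSpace α] (m : Measure α) [hm : IsProbabilityMeasure m] :
    Measure (UM α) :=
  Measure.ofMeasurable (fun s _ => m (mk ⁻¹' s)) (measure_empty (μ := m))
    (fun _ hs hd => measure_iUnion₀ (fun _ _ hij => (hd hij).aedisjoint)
      (fun i => hs i m hm))

theorem extend_apply {α : Type*} [MeasurableSpace α] (m : Measure α) [IsProbabilityMeasure m]
    {s : Set (UM α)} (hs : MeasurableSet s) : extend m s = m (mk ⁻¹' s) :=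
  Measure.ofMeasurable_apply s hs

instance {α : Type*} [MeasurableSpace α] (m : Measure α) [IsProbabilityMeasure m] :
    IsProbabilityMeasure (extend m) :=
  ⟨by rw [extend_apply m MeasurableSet.univ]; exact measure_univ (μ := m)⟩

/-- Values of a universally measurable stochastic kernel on universally measurable sets are
universally measurable. -/
theorem measurable_extend {α β : Type*} [MeasurableSpace α] [MeasurableSpace β]
    (κ : Kernel (UM α) β) [IsMarkovKernel κ] : Measurable fun a => extend (κ a) := by
  refine Measure.measurable_of_measurable_coe _ fun s hs => ?_
  simp_rw [extend_apply _ hs]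
  intro t ht p hp
  -- the image of `p` under the kernel
  set m : Measure β := (extend p).bind κ with hm
  have hmp : IsProbabilityMeasure m := by rw [hm]; infer_instance
  obtain ⟨s', hs', hss'⟩ := hs m hmp
  have h1 : ∀ᵐ a ∂(extend p), κ a (mk ⁻¹' s) = κ a s' := by
    have h2 : ∀ᵐ a ∂(extend p), (mk ⁻¹' s : Set β) =ᵐ[κ a] s' :=
      Measure.ae_ae_of_ae_bind κ.measurable.aemeasurable hss'
    filter_upwards [h2] with a ha using measure_congr ha
  have h3 : MeasurableSet ((fun a => κ a s') ⁻¹' t) := κ.measurable_coe hs' ht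
  -- a null set of the extension is a null set of `p`
  obtain ⟨z, hz, hzm, hz0⟩ := exists_measurable_superset_of_null (ae_iff.1 h1)
  rw [extend_apply p hzm] at hz0
  refine NullMeasurableSet.congr (h3 p hp) ?_
  have h4 : ∀ᵐ a ∂p, a ∉ (mk ⁻¹' z : Set α) := measure_eq_zero_iff_ae_notMem.1 hz0
  filter_upwards [h4] with a ha
  have h5 : κ (mk a) (mk ⁻¹' s) = κ (mk a) s' := by
    by_contra hne
    exact ha (hz hne)
  change (κ (mk a) s' ∈ t) = (κ (mk a) (mk ⁻¹' s) ∈ t)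
  rw [h5]

/-- The extension of a universally measurable stochastic kernel to universally measurable sets. -/
def complete {α β : Type*} [MeasurableSpace α] [MeasurableSpace β]
    (κ : Kernel (UM α) β) [IsMarkovKernel κ] : Kernel (UM α) (UM β) where
  toFun a := extend (κ a)
  measurable' := measurable_extend κ

instance {α β : Type*} [MeasurableSpace α] [MeasurableSpace β]
    (κ : Kernel (UM α) β) [IsMarkovKernel κ] : IsMarkovKernel (complete κ) :=
  ⟨fun a => inferInstanceAs (IsProbabilityMeasure (extend (κ a)))⟩

end UM

/-! ### General Markov decision processes, policies, control strategies -/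

/-- A general Markov decision process with output space `Y`. -/
structure GMDP (Y : Type v) [MeasurableSpace Y] where
  /-- state space -/
  X : Type u
  [topX : TopologicalSpace X]
  [polishX : PolishSpace X]
  [measX : MeasurableSpace X]
  [borelX : BorelSpace X]
  /-- control space -/
  A : Type u
  [topA : TopologicalSpace A]
  [polishA : PolishSpace A]
  [measA : MeasurableSpace A]
  [borelA : BorelSpace A]
  /-- initial probability measure -/
  init : Measure X
  [probInit : IsProbabilityMeasure init]
  /-- transition kernel -/
  T : Kernel (X × A) X
  [markovT : IsMarkovKernel T]
  /-- output map -/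
  h : X → Y
  measurable_h : Measurable h

attribute [instance] GMDP.topX GMDP.polishX GMDP.measX GMDP.borelX GMDP.topA GMDP.polishA
  GMDP.measA GMDP.borelA GMDP.probInit GMDP.markovT

/-- The transition measure `T(· | x, μᵤ) = ∫ T(· | x, u) μᵤ(du)` for a stochastic control `μᵤ`. -/
def GMDP.trans {Y : Type v} [MeasurableSpace Y] (M : GMDP.{u, v} Y) (x : M.X) (μu : Measure M.A) :
    Measure M.X :=
  μu.bind fun a => M.T (x, a)

/-- A Markov policy: a sequence of universally measurable maps from states to probability measures
on the control space. -/
structure MarkovPolicy {Y : Type v} [MeasurableSpace Y] (M : GMDP.{u, v} Y) where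
  map : ℕ → Kernel (UM M.X) M.A
  [markov : ∀ t, IsMarkovKernel (map t)]

attribute [instance] MarkovPolicy.markov

/-- A policy is time-homogeneous if it uses the same map at all times. -/
def MarkovPolicy.IsTimeHomogeneous {Y : Type v} [MeasurableSpace Y] {M : GMDP.{u, v} Y}
    (μ : MarkovPolicy M) : Prop :=
  ∀ t, μ.map t = μ.map 0

/-- A control strategy for `M`: a Polish space of internal states, an initial internal state, a
universally measurable stochastic kernel that updates the internal state from its present value and
the observed state of `M`, and a universally measurable map from internal states to probability
measures on the control space. -/
structure ControlStrategy {Y : Type v} [MeasurableSpace Y] (M : GMDP.{u, v} Y) where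
  XC : Type u
  [topXC : TopologicalSpace XC]
  [polishXC : PolishSpace XC]
  [measXC : MeasurableSpace XC]
  [borelXC : BorelSpace XC]
  init : XC
  T : Kernel (UM (XC × M.X)) XC
  [markovT : IsMarkovKernel T]
  h : Kernel (UM XC) M.A
  [markovH : IsMarkovKernel h]

attribute [instance] ControlStrategy.topXC ControlStrategy.polishXC ControlStrategy.measXC
  ControlStrategy.borelXC ControlStrategy.markovT ControlStrategy.markovH

namespace ControlStrategy

variable {Y : Type v} [MeasurableSpace Y] {M : GMDP.{u, v} Y}

/-- Given the present pair `(c, x)` of internal state and state, and the updated internal state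
`c'`: draw a control `a ∼ h(c')` and then the next state from `T(· | x, a)`. -/
def next (C : ControlStrategy M) : Kernel (UM (C.XC × M.X) × UM C.XC) M.X :=
  M.T ∘ₖ
    (Kernel.deterministic (fun p : UM (C.XC × M.X) × UM C.XC => (UM.get p.1).2)
        (measurable_snd.comp (UM.measurable_get.comp measurable_fst)) ×ₖ
      C.h.comap Prod.snd measurable_snd)

instance (C : ControlStrategy M) : IsMarkovKernel C.next := by
  unfold next; infer_instance

/-- One step of the controlled process from `(c, x)`: draw `c' ∼ T_C(· | c, x)`, then `a ∼ h_C(c')`,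
then `x' ∼ T(· | x, a)`, and move to `(c', x')`. -/
def step (C : ControlStrategy M) : Kernel (UM (C.XC × M.X)) (C.XC × M.X) :=
  (UM.complete C.T ⊗ₖ C.next).map (Prod.map UM.get id)

instance (C : ControlStrategy M) : IsMarkovKernel C.step :=
  Kernel.IsMarkovKernel.map _ (UM.measurable_get.prodMap measurable_id)

/-- The distribution of the executions of `M` controlled with `C`, on the space of
infinite sequences of pairs of an internal state and a state. -/
def law (C : ControlStrategy M) : Measure (ℕ → C.XC × M.X) :=
  (Kernel.trajMeasure (X := fun _ => UM (C.XC × M.X))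
    (UM.extend ((Measure.dirac C.init).prod M.init))
    (fun n => (UM.complete C.step).comap
      (fun w : (Π _ : Finset.Iic n, UM (C.XC × M.X)) => w ⟨n, Finset.mem_Iic.2 le_rfl⟩)
      (measurable_pi_apply _))).map
    (fun w n => UM.get (w n))

/-- The probability that the output of the controlled process is in `K` at some time `t ≤ N`. -/
def probReachWithin (C : ControlStrategy M) (N : ℕ) (K : Set Y) : ℝ :=
  C.law.real {w | ∃ t ≤ N, M.h (w t).2 ∈ K}

/-- The probability that the output of the controlled process is in `K` at some time. -/
def probReach (C : ControlStrategy M) (K : Set Y) : ℝ :=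
  C.law.real {w | ∃ t, M.h (w t).2 ∈ K}

end ControlStrategy

/-! ### Approximate simulation relations -/

/-- `W` is a lifting, with error `δ`, of the relation `R` between the probability measures
`Δ` and `Θ`. -/
structure IsLifting {X₁ X₂ : Type*} [MeasurableSpace X₁] [MeasurableSpace X₂]
    (δ : ℝ) (R : Set (X₁ × X₂)) (Δ : Measure X₁) (Θ : Measure X₂) (W : Measure (X₁ × X₂)) :
    Prop where
  prob : IsProbabilityMeasure W
  left : ∀ B : Set X₁, MeasurableSet B → W (B ×ˢ Set.univ) = Δ B
  right : ∀ B : Set X₂, MeasurableSet B → W (Set.univ ×ˢ B) = Θ B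
  rel : 1 - δ ≤ W.real R

/-- `M₁` is `(ε, δ)`-stochastically simulated by `M₂`. -/
def StochasticallySimulated {Y : Type v} [MetricSpace Y] [MeasurableSpace Y]
    (ε δ : ℝ) (M₁ M₂ : GMDP.{u, v} Y) : Prop :=
  ∃ (U : Kernel (M₁.A × M₁.X × M₂.X) M₂.A) (_ : IsMarkovKernel U)
    (R : Set (M₁.X × M₂.X)) (_ : MeasurableSet R)
    (W : Kernel (M₁.A × M₁.X × M₂.X) (M₁.X × M₂.X)) (_ : IsMarkovKernel W),
    (∀ x₁ x₂, (x₁, x₂) ∈ R → dist (M₁.h x₁) (M₂.h x₂) ≤ ε) ∧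
    (∀ x₁ x₂, (x₁, x₂) ∈ R → ∀ a : M₁.A,
      IsLifting δ R (M₁.T (x₁, a)) (M₂.trans x₂ (U (a, x₁, x₂))) (W (a, x₁, x₂))) ∧
    (∃ W₀ : Measure (M₁.X × M₂.X), IsLifting δ R M₁.init M₂.init W₀)

/-! ### Robust reachability -/

/-- The Markov policy `μ` for `M₁` `(ε, δ)`-robustly reaches `K` within `N` steps with
probability `p`: every `M₂` that `(ε, δ)`-simulates `M₁` has a control strategy under which `K` is
reached within `N` steps with probability at least `p`. (The notion does not constrain how the
strategy for `M₂` is obtained from `μ`.) -/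
def RobustlyReachesWithin {Y : Type v} [MetricSpace Y] [MeasurableSpace Y] (ε δ : ℝ)
    (M₁ : GMDP.{u, v} Y) (_μ : MarkovPolicy M₁) (N : ℕ) (K : Set Y) (p : ℝ) : Prop :=
  ∀ M₂ : GMDP.{u, v} Y, StochasticallySimulated ε δ M₁ M₂ →
    ∃ C₂ : ControlStrategy M₂, p ≤ C₂.probReachWithin N K

/-- The Markov policy `μ` for `M₁` `(ε, δ)`-robustly reaches `K` (at some time) with
probability `p`. -/
def RobustlyReaches {Y : Type v} [MetricSpace Y] [MeasurableSpace Y] (ε δ : ℝ)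
    (M₁ : GMDP.{u, v} Y) (_μ : MarkovPolicy M₁) (K : Set Y) (p : ℝ) : Prop :=
  ∀ M₂ : GMDP.{u, v} Y, StochasticallySimulated ε δ M₁ M₂ →
    ∃ C₂ : ControlStrategy M₂, p ≤ C₂.probReach K

/-- The truncation to `[0, 1]`. -/
def trunc (z : ℝ) : ℝ := min 1 (max 0 z)

section Value

variable {Y : Type v} [MeasurableSpace Y] (M : GMDP.{u, v} Y) (δ : ℝ) (K : Set M.X)

/-- The operator `T_δ^ν` for the target set `K` of states. -/
def robustOp (ν : Kernel (UM M.X) M.A) (V : M.X → ℝ) (x : M.X) : ℝ :=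
  trunc ((∫ y, (K.indicator 1 y + Kᶜ.indicator V y) ∂(M.trans x (ν (UM.mk x)))) - δ)

/-- `valueFn M δ K μ n k` is the value function at time `k` when `n` steps remain, that is,
`V_k^δ` for the horizon `N = k + n`: it is `0` for `n = 0`, and
`V_k^δ = T_δ^{μ_k} (V_{k+1}^δ)` otherwise. -/
def valueFn (μ : MarkovPolicy M) : ℕ → ℕ → M.X → ℝ
  | 0, _ => 0
  | n + 1, k => robustOp M δ K (μ.map k) (valueFn μ n (k + 1))

/-- The pointwise limit of the sequence `(T_δ^ν)^q (0)`. -/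
def limitValueFn (ν : Kernel (UM M.X) M.A) (x : M.X) : ℝ :=
  limUnder atTop fun q : ℕ => (robustOp M δ K ν)^[q] 0 x

/-- `L(∫ [1_K + 1_{X \ K} V] dπ - δ)`, where `π` is the initial measure. -/
def initialValue (V : M.X → ℝ) : ℝ :=
  trunc ((∫ x, (K.indicator 1 x + Kᶜ.indicator V x) ∂M.init) - δ)

/-- The `δ`-robust probability `r^μ(K, N)`, with `V_0^δ` for the horizon `N`. -/
def robustProbWithin (μ : MarkovPolicy M) (N : ℕ) : ℝ :=
  initialValue M δ K (valueFn M δ K μ N 0)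

/-- The `δ`-robust probability `r^μ(K)` of the time-homogeneous policy `μ = (ν, ν, …)`. -/
def robustProb (ν : Kernel (UM M.X) M.A) : ℝ :=
  initialValue M δ K (limitValueFn M δ K ν)

end Value

/-- The `ε`-erosion of `K`: the points all of whose `ε`-close points are in `K`. -/
def erosion {Y : Type v} [MetricSpace Y] (ε : ℝ) (K : Set Y) : Set Y :=
  {y | ∀ y' : Y, dist y' y ≤ ε → y' ∈ K}

end

/-! The controller of `M₂` simulates a run of `M₁` on the side. It remembers the last pair (x₁, x₂)
and the last simulated control u₁. On observing the next state x₂' of `M₂`, it draws x₁' from the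
conditional law, under W(· | u₁, x₁, x₂), of the first coordinate given x₂' (`posteriorKernel`). It
then draws a control from `μ` at x₁' and refines it with `U`. As long as (x₁, x₂) lies in `R`, the
law of x₂' is the second marginal of W, so the new pair has law W (`bind_trackingKernel`).

Put G = h₁⁻¹(Kε). Count the payoff 1_G + 1_{X∖G} V on `R` only, and average it over the posterior
(`trackingPayoff`). If the output of `M₂` is outside `K`, every pair of `R` over the present state
has x₁ ∉ G, so its payoff is V. A payoff bounded by 1 loses at most δ when restricted to `R`
(`IsLifting.lintegral_le`), which the term -δ in the operator compensates. Hence outside `K` the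
tracked payoff with n + 1 steps left is at most its expectation one step later with n steps left
(`valueFn_succ_le`). Pairs outside `R` count 0 and require nothing.

Backward induction along the controlled chain (`lintegral_le_trajMeasure_reach`) turns this into a
lower bound for the reachability probability. The strategy does not depend on the horizon
(`StochasticallySimulated.exists_strategy`), so the unbounded case follows by letting N tend to
infinity. -/

noncomputable section

/-! ### Integration over the universally measurable σ-algebra. -/

namespace UM

variable {α β γ : Type*} [MeasurableSpace α] [MeasurableSpace β] [MeasurableSpace γ]

/-- A Borel map is measurable for the universally measurable sets on both sides. -/
theorem measurable_mk_comp_get {φ : α → β} (hφ : Measurable φ) :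
    Measurable fun x : UM α => (mk (φ x.get) : UM β) := by
  intro s hs p hp
  have := Measure.isProbabilityMeasure_map (μ := p) hφ.aemeasurable
  exact (hs (p.map φ) this).preimage ⟨hφ, Measure.AbsolutelyContinuous.rfl⟩

theorem nullMeasurable_comp_mk {f : UM α → β} (hf : Measurable f) (m : Measure α)
    [hm : IsProbabilityMeasure m] : NullMeasurable (fun x => f (mk x)) m :=
  fun _ hs => hf hs m hm

theorem aemeasurable_comp_mk {f : UM α → ENNReal} (hf : Measurable f) (m : Measure α)
    [IsProbabilityMeasure m] : AEMeasurable (fun x => f (mk x)) m :=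
  (nullMeasurable_comp_mk hf m).aemeasurable

/-- Universally measurable integrands are only a.e. measurable for `m`. This identity allows kernel
measurability to be used on the extended side and ordinary integrals on the other. -/
theorem lintegral_extend (m : Measure α) [hm : IsProbabilityMeasure m] {f : UM α → ENNReal}
    (hf : Measurable f) : ∫⁻ x, f x ∂(extend m) = ∫⁻ x, f (mk x) ∂m := by
  refine Measurable.ennreal_induction (motive := fun f => ∫⁻ x, f x ∂(extend m) = ∫⁻ x, f (mk x) ∂m)
    ?_ ?_ ?_ hf
  · intro c s hs
    rw [lintegral_indicator_const hs, extend_apply m hs]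
    exact (lintegral_indicator_const₀ (hs m hm) c).symm
  · intro f g _ hf hg h1 h2
    simp only [Pi.add_apply]
    rw [lintegral_add_left hf, h1, h2, lintegral_add_left' (aemeasurable_comp_mk hf m)]
  · intro f hf hmono h
    rw [lintegral_iSup hf hmono, lintegral_iSup' (fun n => aemeasurable_comp_mk (hf n) m)
      (Eventually.of_forall fun x i j hij => hmono hij _)]
    simp_rw [h]

theorem lintegral_extend_of_eq_map {m' : Measure β} [IsProbabilityMeasure m'] {m : Measure α}
    {φ : α → β} (hφ : Measurable φ) (h : m' = m.map φ) {f : UM β → ENNReal} (hf : Measurable f) :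
    ∫⁻ x, f x ∂(extend m') = ∫⁻ x, f (mk (φ x)) ∂m := by
  have hf' := aemeasurable_comp_mk hf m'
  rw [lintegral_extend _ hf]
  subst h
  exact lintegral_map' hf' hφ.aemeasurable

/-- Extending a mixture to the universally measurable sets means mixing the extensions. -/
theorem lintegral_extend_of_eq_bind {m' : Measure β} [IsProbabilityMeasure m'] {m : Measure α}
    {κ : Kernel α β} [IsMarkovKernel κ] (h : m' = m.bind κ) {f : UM β → ENNReal}
    (hf : Measurable f) :
    ∫⁻ x, f x ∂(extend m') = ∫⁻ a, ∫⁻ x, f x ∂(extend (κ a)) ∂m := by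
  have hf' := aemeasurable_comp_mk hf m'
  rw [lintegral_extend _ hf]
  subst h
  rw [Measure.lintegral_bind κ.measurable.aemeasurable hf']
  exact lintegral_congr fun a => (lintegral_extend _ hf).symm

theorem measurable_lintegral_extend (κ : Kernel (UM α) β) [IsMarkovKernel κ] {f : UM β → ENNReal}
    (hf : Measurable f) : Measurable fun a => ∫⁻ x, f x ∂(extend (κ a)) :=
  hf.lintegral_kernel (κ := complete κ)

end UM

/-! ### Reachability in Markov chains. -/

open Finset Preorder in
theorem ProbabilityTheory.Kernel.lintegral_trajMeasure_zero {X : ℕ → Type*} [∀ n, MeasurableSpace (X n)]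
    {κ : (n : ℕ) → Kernel (Π i : Iic n, X i) (X (n + 1))} [∀ n, IsMarkovKernel (κ n)]
    {μ₀ : Measure (X 0)} [IsProbabilityMeasure μ₀] {f : X 0 → ENNReal} (hf : Measurable f) :
    ∫⁻ w, f (w 0) ∂(trajMeasure μ₀ κ) = ∫⁻ x, f x ∂μ₀ := by
  have h : (trajMeasure μ₀ κ).map (frestrictLe 0) = μ₀.map (MeasurableEquiv.piUnique _).symm := by
    rw [trajMeasure, Measure.map_comp _ _ (by fun_prop), traj_map_frestrictLe]
    simp [Measure.id_comp]
  have h1 : Measurable fun w : (Π i : Iic 0, X i) => f (w ⟨0, mem_Iic.2 le_rfl⟩) := by fun_prop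
  calc ∫⁻ w, f (w 0) ∂(trajMeasure μ₀ κ)
      = ∫⁻ w, f (w ⟨0, mem_Iic.2 le_rfl⟩) ∂((trajMeasure μ₀ κ).map (frestrictLe 0)) :=
        (MeasureTheory.lintegral_map h1 (measurable_frestrictLe 0)).symm
    _ = ∫⁻ w : (Π i : Iic 0, X i), f (w ⟨0, mem_Iic.2 le_rfl⟩)
          ∂(μ₀.map (MeasurableEquiv.piUnique (fun i : Iic 0 => X i)).symm) := by
        rw [h]; rfl
    _ = ∫⁻ x, f x ∂μ₀ := MeasureTheory.lintegral_map h1 (MeasurableEquiv.measurable _)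

-- The Markov property for integrands that may depend on the whole past, as needed to remember
-- whether the target has already been hit.
open Finset Preorder in
theorem ProbabilityTheory.Kernel.lintegral_trajMeasure_succ {S : Type*} [MeasurableSpace S]
    (κ : Kernel S S) [IsMarkovKernel κ] (μ₀ : Measure S) [IsProbabilityMeasure μ₀] (k : ℕ)
    {f : (Π _ : Iic k, S) → S → ENNReal} (hf : Measurable (Function.uncurry f)) :
    ∫⁻ w, f (frestrictLe (π := fun _ => S) k w) (w (k + 1)) ∂(trajMeasure (X := fun _ => S) μ₀ (fun n => κ.comap
      (fun w : (Π _ : Finset.Iic n, S) => w ⟨n, mem_Iic.2 le_rfl⟩) (measurable_pi_apply _))) =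
    ∫⁻ w, ∫⁻ y, f (frestrictLe (π := fun _ => S) k w) y ∂(κ (w k)) ∂(trajMeasure (X := fun _ => S) μ₀ (fun n => κ.comap
      (fun w : (Π _ : Finset.Iic n, S) => w ⟨n, mem_Iic.2 le_rfl⟩) (measurable_pi_apply _))) := by
  set K : (n : ℕ) → Kernel (Π _ : Iic n, S) S := fun n => κ.comap
      (fun w : (Π _ : Finset.Iic n, S) => w ⟨n, mem_Iic.2 le_rfl⟩) (measurable_pi_apply _) with hK
  have : ∀ n, IsMarkovKernel (K n) := fun n => by rw [hK]; infer_instance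
  have h := map_frestrictLe_trajMeasure_compProd_eq_map_trajMeasure (X := fun _ => S) (κ := K)
    (μ₀ := μ₀) (a := k)
  have hm : Measurable fun w : ℕ → S => (frestrictLe (π := fun _ => S) k w, w (k + 1)) :=
    (measurable_frestrictLe k).prodMk (measurable_pi_apply _)
  have h2 := MeasureTheory.lintegral_map (μ := trajMeasure (X := fun _ => S) μ₀ K) hf hm
  rw [← h, Measure.lintegral_compProd hf, MeasureTheory.lintegral_map hf.lintegral_kernel_prod_right'
    (measurable_frestrictLe k)] at h2
  exact h2.symm

open Finset Preorder in
/-- Lower bounds for reachability probabilities of a Markov chain by backward induction. -/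
theorem ProbabilityTheory.Kernel.lintegral_le_trajMeasure_reach {S : Type*} [MeasurableSpace S]
    (κ : Kernel S S) [IsMarkovKernel κ] (μ₀ : Measure S) [IsProbabilityMeasure μ₀] {B : Set S}
    (hB : MeasurableSet B) {g : ℕ → S → ENNReal} (hg : ∀ n, Measurable (g n))
    (hg1 : ∀ n z, g n z ≤ 1) (hg0 : ∀ z ∉ B, g 0 z = 0)
    (hgs : ∀ n, ∀ z ∉ B, g (n + 1) z ≤ ∫⁻ y, g n y ∂(κ z)) (N : ℕ) :
    ∫⁻ z, g N z ∂μ₀ ≤ trajMeasure (X := fun _ => S) μ₀ (fun n => κ.comap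
      (fun w : (Π _ : Finset.Iic n, S) => w ⟨n, mem_Iic.2 le_rfl⟩) (measurable_pi_apply _))
      {w | ∃ t ≤ N, w t ∈ B} := by
  classical
  set P := trajMeasure (X := fun _ => S) μ₀ (fun n => κ.comap
      (fun w : (Π _ : Finset.Iic n, S) => w ⟨n, mem_Iic.2 le_rfl⟩) (measurable_pi_apply _)) with hP
  have hmem : ∀ k : ℕ, MeasurableSet {w : Π _ : Iic k, S | ∃ t, w t ∈ B} := fun k => by
    rw [Set.ofPred_exists]
    exact MeasurableSet.iUnion fun t => measurable_pi_apply t hB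
  -- The expectation of `φ k` is nondecreasing in `k`: it starts as the integral of `g N`, and `φ N`
  -- is at most the indicator of the event. Only hits strictly before `k` are frozen at 1, so `g`
  -- need not equal 1 on `B`; `g ≤ 1` suffices.
  set φ : ℕ → (ℕ → S) → ENNReal := fun k w => if ∃ t < k, w t ∈ B then 1 else g (N - k) (w k)
  have hstep : ∀ k < N, ∫⁻ w, φ k w ∂P ≤ ∫⁻ w, φ (k + 1) w ∂P := by
    intro k hk
    set f : (Π _ : Iic k, S) → S → ENNReal := fun w y =>
      if ∃ t, w t ∈ B then 1 else g (N - (k + 1)) y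
    have hf : Measurable (Function.uncurry f) :=
      Measurable.ite (measurable_fst (hmem k)) measurable_const ((hg _).comp measurable_snd)
    have hex : ∀ w : ℕ → S, (∃ t : Iic k, frestrictLe (π := fun _ => S) k w t ∈ B) ↔
        ∃ t < k + 1, w t ∈ B := fun w =>
      ⟨fun ⟨t, ht⟩ => ⟨t, Nat.lt_succ_of_le (mem_Iic.1 t.2), ht⟩,
        fun ⟨t, h1, h2⟩ => ⟨⟨t, mem_Iic.2 (Nat.le_of_lt_succ h1)⟩, h2⟩⟩
    have h1 : ∀ w, φ (k + 1) w = f (frestrictLe (π := fun _ => S) k w) (w (k + 1)) := fun w => by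
      simp only [φ, f, hex]
    simp_rw [h1]
    rw [hP, lintegral_trajMeasure_succ κ μ₀ k hf]
    refine lintegral_mono fun w => ?_
    simp only [φ, f, hex]
    by_cases h2 : ∃ t < k + 1, w t ∈ B
    · simp only [if_pos h2, MeasureTheory.lintegral_const, measure_univ, mul_one]
      split_ifs
      · exact le_rfl
      · exact hg1 _ _
    · have h3 : ¬ ∃ t < k, w t ∈ B := fun ⟨t, h, h'⟩ => h2 ⟨t, h.trans (Nat.lt_succ_self k), h'⟩
      rw [if_neg h3]
      simp only [h2, if_false]
      have h4 : N - k = N - (k + 1) + 1 := by omega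
      rw [h4]
      exact hgs _ _ fun h => h2 ⟨k, Nat.lt_succ_self k, h⟩
  have hall : ∀ k ≤ N, ∫⁻ w, φ 0 w ∂P ≤ ∫⁻ w, φ k w ∂P := by
    intro k
    induction k with
    | zero => exact fun _ => le_rfl
    | succ k ih => exact fun hk => (ih (Nat.le_of_succ_le hk)).trans (hstep k hk)
  have h0 : ∫⁻ w, φ 0 w ∂P = ∫⁻ z, g N z ∂μ₀ := by
    simp only [φ, Nat.not_lt_zero, false_and, exists_false, if_false, Nat.sub_zero]
    exact lintegral_trajMeasure_zero (X := fun _ => S) (hg N)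
  have hmeas : MeasurableSet {w : ℕ → S | ∃ t ≤ N, w t ∈ B} := by
    simp only [Set.ofPred_exists, Set.ofPred_and]
    exact MeasurableSet.iUnion fun t => (MeasurableSet.const _).inter (measurable_pi_apply t hB)
  rw [← h0, ← lintegral_indicator_one hmeas]
  refine (hall N le_rfl).trans (lintegral_mono fun w => ?_)
  simp only [φ, Nat.sub_self, Set.indicator_apply, Set.mem_ofPred_eq, Pi.one_apply]
  by_cases h1 : ∃ t ≤ N, w t ∈ B
  · rw [if_pos h1]
    split_ifs
    · exact le_rfl
    · exact hg1 _ _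
  · rw [if_neg h1, if_neg fun ⟨t, h, h'⟩ => h1 ⟨t, h.le, h'⟩]
    exact (hg0 _ fun h => h1 ⟨N, le_rfl, h⟩).le

/-! ### Truncation and payoffs with values in the unit interval. -/

theorem trunc_mem_Icc (z : ℝ) : trunc z ∈ Set.Icc (0 : ℝ) 1 :=
  ⟨le_min zero_le_one (le_max_left _ _), min_le_left _ _⟩

theorem trunc_mono : Monotone trunc := fun _ _ h => min_le_min le_rfl (max_le_max le_rfl h)

theorem continuous_trunc : Continuous trunc :=
  continuous_const.min (continuous_const.max continuous_id)

theorem ofReal_trunc_le (z : ℝ) : ENNReal.ofReal (trunc z) ≤ ENNReal.ofReal z := by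
  rcases le_total z 0 with h | h
  · simp [trunc, h]
  · exact ENNReal.ofReal_le_ofReal (by simp [trunc, h])

/-- Universally measurable functions with values in the unit interval. -/
structure UnitValued {α : Type*} [MeasurableSpace α] (f : α → ℝ) : Prop where
  measurable : Measurable fun x : UM α => f x.get
  mem_Icc : ∀ x, f x ∈ Set.Icc (0 : ℝ) 1

namespace UnitValued

variable {α : Type*} [MeasurableSpace α] {f : α → ℝ}

theorem measurable_ofReal (hf : UnitValued f) :
    Measurable fun x : UM α => ENNReal.ofReal (f x.get) :=
  hf.measurable.ennreal_ofReal

theorem ofReal_le_one (hf : UnitValued f) (x : α) : ENNReal.ofReal (f x) ≤ 1 :=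
  ENNReal.ofReal_le_one.2 (hf.mem_Icc x).2

theorem zero : UnitValued (0 : α → ℝ) :=
  ⟨measurable_const, fun _ => ⟨le_rfl, zero_le_one⟩⟩

theorem integrable (hf : UnitValued f) (m : Measure α) [IsProbabilityMeasure m] :
    Integrable f m :=
  Integrable.of_bound
    (UM.nullMeasurable_comp_mk hf.measurable m).aemeasurable.aestronglyMeasurable 1
    (Eventually.of_forall fun x => by
      rw [Real.norm_of_nonneg (hf.mem_Icc x).1]; exact (hf.mem_Icc x).2)

theorem ofReal_integral (hf : UnitValued f) (m : Measure α) [IsProbabilityMeasure m] :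
    ENNReal.ofReal (∫ x, f x ∂m) = ∫⁻ x, ENNReal.ofReal (f x) ∂m :=
  ofReal_integral_eq_lintegral_ofReal (hf.integrable m)
    (Eventually.of_forall fun x => (hf.mem_Icc x).1)

theorem integral_eq (hf : UnitValued f) (m : Measure α) [IsProbabilityMeasure m] :
    ∫ x, f x ∂m = (∫⁻ x, ENNReal.ofReal (f x.get) ∂(UM.extend m)).toReal := by
  rw [UM.lintegral_extend m hf.measurable_ofReal]
  exact (ENNReal.toReal_ofReal (integral_nonneg fun x => (hf.mem_Icc x).1)).symm.trans
    (congrArg _ (hf.ofReal_integral m))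

end UnitValued

/-- The function `1_K + 1_{X \ K} V`. -/
def reachPayoff {α : Type*} (K : Set α) (V : α → ℝ) (x : α) : ℝ :=
  K.indicator 1 x + Kᶜ.indicator V x

section ReachPayoff

variable {α : Type*} {K : Set α} {V W : α → ℝ} {x : α}

theorem reachPayoff_of_mem (hx : x ∈ K) : reachPayoff K V x = 1 := by simp [reachPayoff, hx]

theorem reachPayoff_of_notMem (hx : x ∉ K) : reachPayoff K V x = V x := by simp [reachPayoff, hx]

theorem reachPayoff_mono (h : V ≤ W) : reachPayoff K V ≤ reachPayoff K W := fun _ =>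
  add_le_add le_rfl (Set.indicator_le_indicator (h _))

theorem UnitValued.reachPayoff [MeasurableSpace α] (hV : UnitValued V) (hK : MeasurableSet K) :
    UnitValued (reachPayoff K V) where
  measurable := by
    have hK' : MeasurableSet (UM.get ⁻¹' K) := UM.measurable_get hK
    exact (measurable_one.indicator hK').add (hV.measurable.indicator hK'.compl)
  mem_Icc x := by
    by_cases hx : x ∈ K
    · simp [reachPayoff_of_mem hx]
    · rw [reachPayoff_of_notMem hx]; exact hV.mem_Icc x

theorem UnitValued.tendsto_integral_reachPayoff [MeasurableSpace α] {v : ℕ → α → ℝ}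
    (hv : ∀ n, UnitValued (v n)) (hK : MeasurableSet K)
    (h : ∀ x, Tendsto (fun n => v n x) atTop (𝓝 (V x))) (m : Measure α) [IsProbabilityMeasure m] :
    Tendsto (fun n => ∫ x, _root_.reachPayoff K (v n) x ∂m) atTop
      (𝓝 (∫ x, _root_.reachPayoff K V x ∂m)) := by
  refine tendsto_integral_of_dominated_convergence (fun _ => 1)
    (fun n => (((hv n).reachPayoff hK).integrable m).aestronglyMeasurable) (integrable_const _)
    (fun n => Eventually.of_forall fun x => ?_) (Eventually.of_forall fun x => ?_)
  · have := ((hv n).reachPayoff hK).mem_Icc x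
    rw [Real.norm_of_nonneg this.1]; exact this.2
  · by_cases hx : x ∈ K
    · simp only [reachPayoff_of_mem hx]; exact tendsto_const_nhds
    · simp only [reachPayoff_of_notMem hx]; exact h x

end ReachPayoff

/-! ### Value functions and their monotone limit. -/

section Value

variable {Y : Type v} [MeasurableSpace Y] {M : GMDP.{u, v} Y}

/-- The transition kernel of `M` under the stochastic control `ν`. -/
def GMDP.transKernel (M : GMDP.{u, v} Y) (ν : Kernel (UM M.X) M.A) : Kernel (UM M.X) M.X :=
  M.T ∘ₖ (Kernel.deterministic UM.get UM.measurable_get ×ₖ ν)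

instance (ν : Kernel (UM M.X) M.A) [IsMarkovKernel ν] : IsMarkovKernel (M.transKernel ν) := by
  unfold GMDP.transKernel; infer_instance

theorem bind_deterministic_prod {α β γ δ : Type*} [MeasurableSpace α] [MeasurableSpace β]
    [MeasurableSpace γ] [MeasurableSpace δ] (T : Kernel (β × γ) δ) {φ : α → β} (hφ : Measurable φ)
    (ν : Kernel α γ) [IsSFiniteKernel ν] (a : α) :
    (T ∘ₖ (Kernel.deterministic φ hφ ×ₖ ν)) a = (ν a).bind fun c => T (φ a, c) := by
  have hT : Measurable fun c => T (φ a, c) := T.measurable.comp measurable_prodMk_left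
  ext s hs
  rw [Kernel.comp_apply' _ _ _ hs, Kernel.prod_apply, Kernel.deterministic_apply,
    Measure.dirac_prod, lintegral_map (T.measurable_coe hs) measurable_prodMk_left,
    Measure.bind_apply hs hT.aemeasurable]

theorem GMDP.transKernel_apply (ν : Kernel (UM M.X) M.A) [IsMarkovKernel ν] (x : M.X) :
    M.transKernel ν (UM.mk x) = M.trans x (ν (UM.mk x)) :=
  bind_deterministic_prod _ _ _ _

instance GMDP.isProbabilityMeasure_trans (x : M.X) (m : Measure M.A) [IsProbabilityMeasure m] :
    IsProbabilityMeasure (M.trans x m) := by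
  have hT : Measurable fun a => M.T (x, a) := M.T.measurable.comp measurable_prodMk_left
  exact isProbabilityMeasure_bind hT.aemeasurable (Eventually.of_forall fun a => inferInstance)

variable {δ : ℝ} {K : Set M.X} {ν : Kernel (UM M.X) M.A} [IsMarkovKernel ν] {V W : M.X → ℝ}

theorem UnitValued.robustOp (hV : UnitValued V) (hK : MeasurableSet K) :
    UnitValued (robustOp M δ K ν V) where
  measurable := by
    refine continuous_trunc.measurable.comp (Measurable.sub_const ?_ δ)
    -- `V` is only universally measurable, so measurability in `x` is obtained from the completed
    -- transition kernel.
    have h : ∀ x : UM M.X, ∫ y, _root_.reachPayoff K V y ∂(M.trans x.get (ν (UM.mk x.get))) =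
        (∫⁻ y, ENNReal.ofReal (_root_.reachPayoff K V y.get)
          ∂(UM.extend (M.transKernel ν x))).toReal := fun x => by
      rw [← (hV.reachPayoff hK).integral_eq]
      exact congrArg (fun m => ∫ y, _root_.reachPayoff K V y ∂m) (M.transKernel_apply ν x).symm
    exact (funext h : (fun x : UM M.X => _) = _) ▸
      (UM.measurable_lintegral_extend (M.transKernel ν) (hV.reachPayoff hK).measurable_ofReal).ennreal_toReal
  mem_Icc x := trunc_mem_Icc _

theorem robustOp_mono (hV : UnitValued V) (hW : UnitValued W) (hK : MeasurableSet K) (h : V ≤ W) :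
    robustOp M δ K ν V ≤ robustOp M δ K ν W := fun _ =>
  trunc_mono (sub_le_sub_right (integral_mono ((hV.reachPayoff hK).integrable _)
    ((hW.reachPayoff hK).integrable _) (reachPayoff_mono h)) δ)

theorem UnitValued.valueFn (hK : MeasurableSet K) (μ : MarkovPolicy M) (n k : ℕ) :
    UnitValued (valueFn M δ K μ n k) := by
  induction n generalizing k with
  | zero => exact UnitValued.zero
  | succ n ih => exact (ih (k + 1)).robustOp hK

theorem UnitValued.iterate_robustOp (hK : MeasurableSet K) (q : ℕ) :
    UnitValued ((_root_.robustOp M δ K ν)^[q] 0) := by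
  induction q with
  | zero => exact UnitValued.zero
  | succ q ih => rw [Function.iterate_succ_apply']; exact ih.robustOp hK

theorem iterate_robustOp_le_succ (hK : MeasurableSet K) (q : ℕ) :
    (robustOp M δ K ν)^[q] 0 ≤ (robustOp M δ K ν)^[q + 1] 0 := by
  induction q with
  | zero => exact fun x => ((UnitValued.iterate_robustOp hK 1).mem_Icc x).1
  | succ q ih =>
    rw [Function.iterate_succ_apply', Function.iterate_succ_apply' _ (q + 1)]
    exact robustOp_mono (UnitValued.iterate_robustOp hK _) (UnitValued.iterate_robustOp hK _) hK ih

theorem tendsto_iterate_robustOp (hK : MeasurableSet K) (x : M.X) :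
    Tendsto (fun q : ℕ => (robustOp M δ K ν)^[q] 0 x) atTop (𝓝 (limitValueFn M δ K ν x)) := by
  have hm : Monotone fun q : ℕ => (robustOp M δ K ν)^[q] 0 x :=
    monotone_nat_of_le_succ fun q => iterate_robustOp_le_succ hK q x
  have hb : BddAbove (Set.range fun q : ℕ => (robustOp M δ K ν)^[q] 0 x) :=
    ⟨1, by rintro _ ⟨q, rfl⟩; exact ((UnitValued.iterate_robustOp hK q).mem_Icc x).2⟩
  exact tendsto_nhds_limUnder ⟨_, tendsto_atTop_ciSup hm hb⟩

/-- Dominated convergence passes the limit through the operator, and the shifted sequence of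
iterates has the same limit. -/
theorem robustOp_limitValueFn (hK : MeasurableSet K) :
    robustOp M δ K ν (limitValueFn M δ K ν) = limitValueFn M δ K ν := by
  funext x
  have h1 : Tendsto (fun q : ℕ => (robustOp M δ K ν)^[q + 1] 0 x) atTop
      (𝓝 (robustOp M δ K ν (limitValueFn M δ K ν) x)) := by
    simp only [Function.iterate_succ_apply']
    exact (continuous_trunc.tendsto _).comp
      ((UnitValued.tendsto_integral_reachPayoff (UnitValued.iterate_robustOp hK) hK
        (tendsto_iterate_robustOp hK) (M.trans x (ν (UM.mk x)))).sub_const δ)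
  exact tendsto_nhds_unique h1 ((tendsto_add_atTop_iff_nat 1).2 (tendsto_iterate_robustOp hK x))

theorem tendsto_initialValue_iterate (hK : MeasurableSet K) :
    Tendsto (fun q : ℕ => initialValue M δ K ((robustOp M δ K ν)^[q] 0)) atTop
      (𝓝 (robustProb M δ K ν)) :=
  (continuous_trunc.tendsto _).comp
    ((UnitValued.tendsto_integral_reachPayoff (UnitValued.iterate_robustOp hK) hK
      (tendsto_iterate_robustOp hK) M.init).sub_const δ)

theorem MarkovPolicy.IsTimeHomogeneous.valueFn_eq {μ : MarkovPolicy M} (hμ : μ.IsTimeHomogeneous)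
    (n k : ℕ) : valueFn M δ K μ n k = (robustOp M δ K (μ.map 0))^[n] 0 := by
  induction n generalizing k with
  | zero => rfl
  | succ n ih => rw [Function.iterate_succ_apply', ← ih (k + 1), valueFn, hμ k]

end Value

/-! ### Disintegration of the coupling. -/

section Tracking

variable {X₁ X₂ A : Type*} [MeasurableSpace X₁] [MeasurableSpace X₂] [MeasurableSpace A]

/-- Time is countable, so measurability at each fixed time suffices; the state projection is Borel,
hence measurable for universally measurable sets. -/
theorem UM.measurable_of_fst_nat {γ : Type*} [MeasurableSpace γ] {f : ℕ → UM X₁ → γ}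
    (hf : ∀ t, Measurable (f t)) :
    Measurable fun p : UM (ℕ × X₁ × X₂) => f p.get.1 (UM.mk p.get.2.1) :=
  (measurable_from_prod_countable_right (f := fun q : ℕ × UM X₁ => f q.1 q.2) hf).comp
    ((measurable_fst.comp UM.measurable_get).prodMk
      (UM.measurable_mk_comp_get (measurable_fst.comp measurable_snd)))

/-- The coupling that produces the pair of states at the next time: `W₀` at time `0`, and `W` at
the pair of states and the control that are recorded afterwards. -/
def couplingKernel (W₀ : Measure (X₁ × X₂)) (W : Kernel (A × X₁ × X₂) (X₁ × X₂)) :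
    Kernel ((ℕ × X₁ × X₂) × A) (X₁ × X₂) where
  toFun c := if c.1.1 = 0 then W₀ else W (c.2, c.1.2)
  measurable' := Measurable.ite ((measurable_fst.comp measurable_fst) (measurableSet_singleton 0))
    measurable_const (W.measurable.comp (by fun_prop))

variable (W₀ : Measure (X₁ × X₂)) (W : Kernel (A × X₁ × X₂) (X₁ × X₂))

variable [IsProbabilityMeasure W₀] [IsMarkovKernel W]

instance : IsMarkovKernel (couplingKernel W₀ W) := by
  refine ⟨fun c => ?_⟩
  change IsProbabilityMeasure (if c.1.1 = 0 then W₀ else W (c.2, c.1.2))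
  split_ifs <;> infer_instance

variable [StandardBorelSpace X₁] [Nonempty X₁] [MeasurableSpace.CountablyGenerated X₂]

/-- The conditional distribution of the first state of the coupling given the second one. -/
def posteriorKernel : Kernel (((ℕ × X₁ × X₂) × A) × X₂) X₁ :=
  -- `condKernel` conditions on the first coordinate, hence the swap.
  ((couplingKernel W₀ W).map Prod.swap).condKernel

instance : IsMarkovKernel (posteriorKernel W₀ W) := by
  unfold posteriorKernel; infer_instance

/-- The conditional distribution of the time and the pair of states, given the record and the
second state. -/
def trackingKernel : Kernel (((ℕ × X₁ × X₂) × A) × X₂) (ℕ × X₁ × X₂) :=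
  (Kernel.id ×ₖ posteriorKernel W₀ W).map fun p => (p.1.1.1.1, p.2, p.1.2)

instance : IsMarkovKernel (trackingKernel W₀ W) := by
  unfold trackingKernel; exact Kernel.IsMarkovKernel.map _ (by fun_prop)

theorem trackingKernel_apply (z : ((ℕ × X₁ × X₂) × A) × X₂) :
    trackingKernel W₀ W z = (posteriorKernel W₀ W z).map fun x => (z.1.1.1, x, z.2) := by
  rw [trackingKernel, Kernel.map_apply _ (by fun_prop), Kernel.prod_apply, Kernel.id_apply,
    Measure.dirac_prod, Measure.map_map (by fun_prop) (by fun_prop)]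
  rfl

/-- Disintegration: the second marginal followed by the posterior restores the coupling. -/
theorem bind_trackingKernel (c : (ℕ × X₁ × X₂) × A) :
    (couplingKernel W₀ W c).map (Prod.mk c.1.1) =
      ((couplingKernel W₀ W c).map Prod.snd).bind
        ((trackingKernel W₀ W).comap (Prod.mk c) measurable_prodMk_left) := by
  set ρ := (couplingKernel W₀ W).map Prod.swap with hρ
  have : IsMarkovKernel ρ := Kernel.IsMarkovKernel.map _ measurable_swap
  have h1 : (ρ.fst ⊗ₖ posteriorKernel W₀ W) c = ρ c := by
    have : ρ.fst ⊗ₖ ρ.condKernel = ρ := ρ.disintegrate ρ.condKernel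
    exact congrArg (fun η => η c) this
  have h2 : ρ.fst c = (couplingKernel W₀ W c).map Prod.snd := by
    rw [Kernel.fst_apply, hρ, Kernel.map_apply _ measurable_swap,
      Measure.map_map measurable_fst measurable_swap]
    rfl
  have h3 : (couplingKernel W₀ W c).map (Prod.mk c.1.1) = (ρ c).map fun p => (c.1.1, p.2, p.1) := by
    rw [hρ, Kernel.map_apply _ measurable_swap, Measure.map_map (by fun_prop) measurable_swap]
    rfl
  have hm : Measurable fun p : X₂ × X₁ => (c.1.1, p.2, p.1) := by fun_prop
  ext s hs
  rw [h3, ← h1, Measure.map_apply hm hs, Kernel.compProd_apply (hm hs), h2,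
    Measure.bind_apply hs (Kernel.measurable _).aemeasurable]
  refine lintegral_congr fun x => ?_
  rw [Kernel.comap_apply, trackingKernel_apply, Measure.map_apply (by fun_prop) hs]
  rfl

theorem lintegral_trackingKernel (c : (ℕ × X₁ × X₂) × A) {H : UM (ℕ × X₁ × X₂) → ENNReal}
    (hH : Measurable H) {Θ : Measure X₂} (hΘ : Θ = (couplingKernel W₀ W c).map Prod.snd) :
    ∫⁻ x, ∫⁻ p, H p ∂(UM.extend (trackingKernel W₀ W (c, x))) ∂Θ =
      ∫⁻ y, H (UM.mk (c.1.1, y)) ∂(couplingKernel W₀ W c) := by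
  have : IsProbabilityMeasure ((couplingKernel W₀ W c).map (Prod.mk c.1.1)) :=
    Measure.isProbabilityMeasure_map (by fun_prop)
  subst hΘ
  rw [← UM.lintegral_extend_of_eq_map measurable_prodMk_left rfl hH,
    UM.lintegral_extend_of_eq_bind (bind_trackingKernel W₀ W c) hH]
  rfl

end Tracking

/-! ### Liftings -/

section Lifting

variable {X₁ X₂ : Type*} [MeasurableSpace X₁] [MeasurableSpace X₂] {δ : ℝ} {R : Set (X₁ × X₂)}
  {Δ : Measure X₁} {Θ : Measure X₂} {W : Measure (X₁ × X₂)}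

theorem IsLifting.map_fst (h : IsLifting δ R Δ Θ W) : Δ = W.map Prod.fst := by
  ext B hB
  rw [Measure.map_apply measurable_fst hB, ← h.left B hB, Set.prod_univ]

theorem IsLifting.map_snd (h : IsLifting δ R Δ Θ W) : Θ = W.map Prod.snd := by
  ext B hB
  rw [Measure.map_apply measurable_snd hB, ← h.right B hB, Set.univ_prod]

theorem IsLifting.measure_compl_le (h : IsLifting δ R Δ Θ W) (hR : MeasurableSet R) :
    W Rᶜ ≤ ENNReal.ofReal δ := by
  have := h.prob
  rw [← ofReal_measureReal, probReal_compl_eq_one_sub hR]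
  exact ENNReal.ofReal_le_ofReal (by linarith [h.rel])

/-- Since `f ≤ 1`, discarding the pairs outside `R` costs at most their mass, which is at most δ. -/
theorem IsLifting.lintegral_le (h : IsLifting δ R Δ Θ W) (hR : MeasurableSet R) {f : X₁ → ℝ}
    (hf : UnitValued f) :
    ∫⁻ x, ENNReal.ofReal (f x) ∂Δ ≤
      ∫⁻ y, R.indicator (fun y => ENNReal.ofReal (f y.1)) y ∂W + ENNReal.ofReal δ := by
  have := h.prob
  have hm := h.map_fst
  have hΔ : IsProbabilityMeasure Δ := by
    rw [hm]; exact Measure.isProbabilityMeasure_map measurable_fst.aemeasurable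
  have hf' : AEMeasurable (fun x => ENNReal.ofReal (f x)) (W.map Prod.fst) := by
    rw [← hm]; exact UM.aemeasurable_comp_mk hf.measurable_ofReal Δ
  calc ∫⁻ x, ENNReal.ofReal (f x) ∂Δ
      = ∫⁻ y, ENNReal.ofReal (f y.1) ∂W := by
        rw [hm, lintegral_map' hf' measurable_fst.aemeasurable]
    _ ≤ ∫⁻ y, (R.indicator (fun y => ENNReal.ofReal (f y.1)) y + Rᶜ.indicator 1 y) ∂W := by
        refine lintegral_mono fun y => ?_
        by_cases hy : y ∈ R
        · simp [hy]
        · simpa [hy] using (hf.mem_Icc y.1).2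
    _ = ∫⁻ y, R.indicator (fun y => ENNReal.ofReal (f y.1)) y ∂W + W Rᶜ := by
        rw [lintegral_add_right _ (measurable_one.indicator hR.compl),
          lintegral_indicator_one hR.compl]
    _ ≤ _ := add_le_add le_rfl (h.measure_compl_le hR)

end Lifting

theorem UnitValued.ofReal_trunc_integral_sub_le {α : Type*} [MeasurableSpace α] {f : α → ℝ}
    (hf : UnitValued f) (m : Measure α) [IsProbabilityMeasure m] {δ : ℝ} (hδ : 0 ≤ δ) {c : ENNReal}
    (h : ∫⁻ x, ENNReal.ofReal (f x) ∂m ≤ c + ENNReal.ofReal δ) :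
    ENNReal.ofReal (trunc ((∫ x, f x ∂m) - δ)) ≤ c := by
  refine (ofReal_trunc_le _).trans ?_
  rw [ENNReal.ofReal_sub _ hδ, hf.ofReal_integral]
  exact tsub_le_iff_right.2 h

/-! ### One step of a controlled process -/

namespace ControlStrategy

variable {Y : Type v} [MeasurableSpace Y] {M : GMDP.{u, v} Y} (C : ControlStrategy M)

/-- The pair of the updated internal state and the next state, as a kernel in the former. -/
def nextPair (z : UM (C.XC × M.X)) : Kernel (UM C.XC) (C.XC × M.X) :=
  Kernel.deterministic UM.get UM.measurable_get ×ₖ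
    C.next.comap (Prod.mk z) measurable_prodMk_left

instance (z : UM (C.XC × M.X)) : IsMarkovKernel (C.nextPair z) := by
  unfold nextPair; infer_instance

theorem next_apply (z : UM (C.XC × M.X)) (c : UM C.XC) :
    C.next (z, c) = M.trans z.get.2 (C.h c) :=
  bind_deterministic_prod _ _ _ _

theorem nextPair_apply (z : UM (C.XC × M.X)) (c : UM C.XC) :
    C.nextPair z c = (M.trans z.get.2 (C.h c)).map (Prod.mk c.get) := by
  rw [nextPair, Kernel.prod_apply, Kernel.deterministic_apply, Measure.dirac_prod,
    Kernel.comap_apply, next_apply]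

theorem step_apply (z : UM (C.XC × M.X)) :
    C.step z = (UM.extend (C.T z)).bind (C.nextPair z) := by
  have hm : Measurable (Prod.map UM.get id : UM C.XC × M.X → C.XC × M.X) :=
    UM.measurable_get.prodMap measurable_id
  ext s hs
  rw [step, Kernel.map_apply' _ hm _ hs, Kernel.compProd_apply (hm hs),
    Measure.bind_apply hs (Kernel.measurable _).aemeasurable]
  refine lintegral_congr fun c => ?_
  rw [nextPair_apply, Measure.map_apply measurable_prodMk_left hs, next_apply]
  rfl

theorem lintegral_nextPair (z : UM (C.XC × M.X)) (c : UM C.XC) {f : UM (C.XC × M.X) → ENNReal}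
    (hf : Measurable f) : ∫⁻ y, f y ∂(UM.extend (C.nextPair z c)) =
      ∫⁻ x, f (UM.mk (c.get, x)) ∂(M.trans z.get.2 (C.h c)) :=
  UM.lintegral_extend_of_eq_map measurable_prodMk_left (C.nextPair_apply z c) hf

theorem lintegral_step (z : UM (C.XC × M.X)) {f : UM (C.XC × M.X) → ENNReal} (hf : Measurable f) :
    ∫⁻ y, f y ∂(UM.complete C.step z) =
      ∫⁻ c, ∫⁻ y, f y ∂(UM.extend (C.nextPair z c)) ∂(UM.extend (C.T z)) :=
  UM.lintegral_extend_of_eq_bind (C.step_apply z) hf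

theorem measurable_shift : Measurable fun (w : ℕ → UM (C.XC × M.X)) n => UM.get (w n) :=
  measurable_pi_iff.2 fun n => UM.measurable_get.comp (measurable_pi_apply n)

instance : IsProbabilityMeasure C.law :=
  Measure.isProbabilityMeasure_map C.measurable_shift.aemeasurable

/-- Lower bounds for the reachability probabilities of a controlled process by backward
induction. -/
theorem lintegral_le_probReachWithin {K : Set Y} (hK : MeasurableSet K)
    {g : ℕ → UM (C.XC × M.X) → ENNReal} (hg : ∀ n, Measurable (g n)) (hg1 : ∀ n z, g n z ≤ 1)
    (hg0 : ∀ z : UM (C.XC × M.X), M.h z.get.2 ∉ K → g 0 z = 0)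
    (hgs : ∀ n, ∀ z : UM (C.XC × M.X), M.h z.get.2 ∉ K →
      g (n + 1) z ≤ ∫⁻ y, g n y ∂(UM.complete C.step z)) (N : ℕ) :
    ∫⁻ x, g N (UM.mk (C.init, x)) ∂M.init ≤ ENNReal.ofReal (C.probReachWithin N K) := by
  have hB : MeasurableSet {z : UM (C.XC × M.X) | M.h z.get.2 ∈ K} :=
    (M.measurable_h.comp (measurable_snd.comp UM.measurable_get)) hK
  have hE : MeasurableSet {w : ℕ → C.XC × M.X | ∃ t ≤ N, M.h (w t).2 ∈ K} := by
    simp only [Set.ofPred_exists, Set.ofPred_and]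
    exact MeasurableSet.iUnion fun t => (MeasurableSet.const _).inter
      ((M.measurable_h.comp (measurable_snd.comp (measurable_pi_apply t))) hK)
  have h1 := Kernel.lintegral_le_trajMeasure_reach (UM.complete C.step)
    (UM.extend ((Measure.dirac C.init).prod M.init)) hB hg hg1 hg0 hgs N
  rw [UM.lintegral_extend_of_eq_map measurable_prodMk_left (Measure.dirac_prod _) (hg N)] at h1
  rw [probReachWithin, ofReal_measureReal, law, Measure.map_apply C.measurable_shift hE]
  exact h1

theorem probReachWithin_le_probReach (N : ℕ) (K : Set Y) :
    C.probReachWithin N K ≤ C.probReach K :=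
  measureReal_mono fun _ ⟨t, _, ht⟩ => ⟨t, ht⟩

end ControlStrategy

/-! ### The strategy that tracks a simulated process -/

section TrackingStrategy

variable {Y : Type v} [MeasurableSpace Y] {M₁ M₂ : GMDP.{u, v} Y}

/-- The Markov policy `μ` as a kernel in the time and a pair of states. -/
def policyKernel (M₂ : GMDP.{u, v} Y) (μ : MarkovPolicy M₁) :
    Kernel (UM (ℕ × M₁.X × M₂.X)) M₁.A where
  toFun p := μ.map p.get.1 (UM.mk p.get.2.1)
  measurable' := UM.measurable_of_fst_nat fun t => (μ.map t).measurable

instance (μ : MarkovPolicy M₁) : IsMarkovKernel (policyKernel M₂ μ) :=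
  ⟨fun p => inferInstanceAs (IsProbabilityMeasure (μ.map p.get.1 (UM.mk p.get.2.1)))⟩

/-- Draw a control from `μ`, record it with the pair of states, and increment the time. -/
def recordKernel (M₂ : GMDP.{u, v} Y) (μ : MarkovPolicy M₁) :
    Kernel (UM (ℕ × M₁.X × M₂.X)) ((ℕ × M₁.X × M₂.X) × M₁.A) :=
  (Kernel.deterministic UM.get UM.measurable_get ×ₖ policyKernel M₂ μ).map
    fun p => ((p.1.1 + 1, p.1.2), p.2)

theorem measurable_incr {α β : Type*} [MeasurableSpace α] [MeasurableSpace β] :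
    Measurable fun p : (ℕ × α) × β => ((p.1.1 + 1, p.1.2), p.2) := by
  have : Measurable fun t : ℕ => t + 1 := measurable_of_countable _
  fun_prop

instance (μ : MarkovPolicy M₁) : IsMarkovKernel (recordKernel M₂ μ) :=
  Kernel.IsMarkovKernel.map _ measurable_incr

theorem recordKernel_apply (μ : MarkovPolicy M₁) (t : ℕ) (y : M₁.X × M₂.X) :
    recordKernel M₂ μ (UM.mk (t, y)) =
      (μ.map t (UM.mk y.1)).map (Prod.mk (t + 1, y)) := by
  rw [recordKernel, Kernel.map_apply _ measurable_incr, Kernel.prod_apply,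
    Kernel.deterministic_apply, Measure.dirac_prod,
    Measure.map_map measurable_incr measurable_prodMk_left]
  rfl

instance GMDP.nonempty_X (M : GMDP.{u, v} Y) : Nonempty M.X :=
  nonempty_of_isProbabilityMeasure M.init

variable (μ : MarkovPolicy M₁) (U : Kernel (M₁.A × M₁.X × M₂.X) M₂.A)
  (W₀ : Measure (M₁.X × M₂.X)) [IsProbabilityMeasure W₀]
  (W : Kernel (M₁.A × M₁.X × M₂.X) (M₁.X × M₂.X)) [IsMarkovKernel W]

/-- Draw a state of `M₁` from its conditional distribution given the record and the observed state
of `M₂`, draw a control of `M₁` from `μ`, and record both. -/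
def trackingTransition :
    Kernel (UM (((ℕ × M₁.X × M₂.X) × M₁.A) × M₂.X)) ((ℕ × M₁.X × M₂.X) × M₁.A) :=
  recordKernel M₂ μ ∘ₖ UM.complete ((trackingKernel W₀ W).comap UM.get UM.measurable_get)

instance : IsMarkovKernel (trackingTransition μ W₀ W) := by
  unfold trackingTransition; infer_instance

/-- The control strategy for `M₂` that draws a state of `M₁` from its conditional distribution
given the observed state of `M₂`, draws a control of `M₁` from `μ`, records both, and refines the
control with the interface `U`. -/
def trackingStrategy [IsMarkovKernel U] (x₁ : M₁.X) (x₂ : M₂.X) (a : M₁.A) : ControlStrategy M₂ where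
  XC := (ℕ × M₁.X × M₂.X) × M₁.A
  -- The counter is the time of the state about to be observed. At 0 the coupling is `W₀`, so the
  -- recorded states and control are placeholders.
  init := ((0, x₁, x₂), a)
  T := trackingTransition μ W₀ W
  h := U.comap (fun c => (c.get.2, c.get.1.2))
    ((measurable_snd.comp UM.measurable_get).prodMk
      (measurable_snd.comp (measurable_fst.comp UM.measurable_get)))

variable {δ : ℝ} {G : Set M₁.X} {R : Set (M₁.X × M₂.X)}

/-- The payoff in `M₁` when `n` steps remain, counted on the relation `R` only. -/
def relPayoff (δ : ℝ) (G : Set M₁.X) (R : Set (M₁.X × M₂.X)) (μ : MarkovPolicy M₁) (n : ℕ)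
    (p : UM (ℕ × M₁.X × M₂.X)) : ENNReal :=
  R.indicator (fun y => ENNReal.ofReal (reachPayoff G (valueFn M₁ δ G μ n p.get.1) y.1)) p.get.2

theorem measurable_relPayoff (hG : MeasurableSet G) (hR : MeasurableSet R) (n : ℕ) :
    Measurable (relPayoff δ G R μ n) := by
  have h1 : MeasurableSet {p : UM (ℕ × M₁.X × M₂.X) | p.get.2 ∈ R} :=
    (measurable_snd.comp UM.measurable_get) hR
  have h2 : Measurable fun p : UM (ℕ × M₁.X × M₂.X) =>
      ENNReal.ofReal (reachPayoff G (valueFn M₁ δ G μ n p.get.1) p.get.2.1) :=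
    UM.measurable_of_fst_nat (f := fun t x => ENNReal.ofReal
      (reachPayoff G (valueFn M₁ δ G μ n t) x.get))
      fun t => ((UnitValued.valueFn hG μ n t).reachPayoff hG).measurable_ofReal
  exact h2.indicator h1

theorem relPayoff_le_one (hG : MeasurableSet G) (n : ℕ) (p : UM (ℕ × M₁.X × M₂.X)) :
    relPayoff δ G R μ n p ≤ 1 :=
  Set.indicator_apply_le' (fun _ => ((UnitValued.valueFn hG μ n _).reachPayoff hG).ofReal_le_one _)
    fun _ => zero_le_one

theorem relPayoff_le {n t : ℕ} {y : M₁.X × M₂.X} {c : ENNReal} (hy : y ∈ R → y.1 ∉ G)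
    (hc : y ∈ R → ENNReal.ofReal (valueFn M₁ δ G μ n t y.1) ≤ c) :
    relPayoff δ G R μ n (UM.mk (t, y)) ≤ c := by
  refine Set.indicator_apply_le' (fun h => ?_) fun _ => zero_le
  change ENNReal.ofReal (reachPayoff G (valueFn M₁ δ G μ n t) y.1) ≤ c
  rw [reachPayoff_of_notMem (hy h)]
  exact hc h

/-- The expected payoff given the internal state of the tracking strategy and the state of
`M₂`. -/
def trackingPayoff (δ : ℝ) (G : Set M₁.X) (R : Set (M₁.X × M₂.X)) (n : ℕ)
    (z : UM (((ℕ × M₁.X × M₂.X) × M₁.A) × M₂.X)) : ENNReal :=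
  ∫⁻ p, relPayoff δ G R μ n p ∂(UM.extend (trackingKernel W₀ W z.get))

theorem measurable_trackingPayoff (hG : MeasurableSet G) (hR : MeasurableSet R) (n : ℕ) :
    Measurable (trackingPayoff μ W₀ W δ G R n) :=
  UM.measurable_lintegral_extend ((trackingKernel W₀ W).comap UM.get UM.measurable_get)
    (measurable_relPayoff μ hG hR n)

theorem trackingPayoff_eq (hG : MeasurableSet G) (hR : MeasurableSet R) (n : ℕ)
    (z : UM (((ℕ × M₁.X × M₂.X) × M₁.A) × M₂.X)) :
    trackingPayoff μ W₀ W δ G R n z =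
      ∫⁻ x, relPayoff δ G R μ n (UM.mk (z.get.1.1.1, x, z.get.2))
        ∂(posteriorKernel W₀ W z.get) :=
  UM.lintegral_extend_of_eq_map (by fun_prop) (trackingKernel_apply W₀ W z.get)
    (measurable_relPayoff μ hG hR n)

theorem lintegral_trackingTransition
    (z : UM (((ℕ × M₁.X × M₂.X) × M₁.A) × M₂.X))
    {J : UM ((ℕ × M₁.X × M₂.X) × M₁.A) → ENNReal} (hJ : Measurable J) :
    ∫⁻ c, J c ∂(UM.extend (trackingTransition μ W₀ W z)) =
      ∫⁻ x, ∫⁻ u, J (UM.mk ((z.get.1.1.1 + 1, x, z.get.2), u)) ∂(μ.map z.get.1.1.1 (UM.mk x))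
        ∂(posteriorKernel W₀ W z.get) := by
  have h : trackingTransition μ W₀ W z =
      (UM.extend (trackingKernel W₀ W z.get)).bind (recordKernel M₂ μ) := by
    rw [trackingTransition, Kernel.comp_apply]; rfl
  rw [UM.lintegral_extend_of_eq_bind h hJ]
  refine (UM.lintegral_extend_of_eq_map (by fun_prop) (trackingKernel_apply W₀ W z.get)
    (UM.measurable_lintegral_extend (recordKernel M₂ μ) hJ)).trans (lintegral_congr fun x => ?_)
  exact UM.lintegral_extend_of_eq_map measurable_prodMk_left (recordKernel_apply μ _ _) hJ

theorem lintegral_trackingStrategy_step [IsMarkovKernel U] (x₁ : M₁.X) (x₂ : M₂.X) (a : M₁.A)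
    (z : UM (((ℕ × M₁.X × M₂.X) × M₁.A) × M₂.X))
    {f : UM (((ℕ × M₁.X × M₂.X) × M₁.A) × M₂.X) → ENNReal} (hf : Measurable f) :
    ∫⁻ y, f y ∂(UM.complete (trackingStrategy μ U W₀ W x₁ x₂ a).step z) =
      ∫⁻ x, ∫⁻ u, ∫⁻ x', f (UM.mk (((z.get.1.1.1 + 1, x, z.get.2), u), x'))
        ∂(M₂.trans z.get.2 (U (u, x, z.get.2))) ∂(μ.map z.get.1.1.1 (UM.mk x))
        ∂(posteriorKernel W₀ W z.get) := by
  set C := trackingStrategy μ U W₀ W x₁ x₂ a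
  let z' : UM (C.XC × M₂.X) := z
  let f' : UM (C.XC × M₂.X) → ENNReal := f
  have hf' : Measurable f' := hf
  have h2 := UM.measurable_lintegral_extend (C.nextPair z') hf'
  refine (C.lintegral_step z' hf').trans ((lintegral_trackingTransition μ W₀ W z h2).trans ?_)
  exact lintegral_congr fun x => lintegral_congr fun u => C.lintegral_nextPair z' _ hf'

/-- Bellman inequality for the tracked payoff along one pair of states in the relation. -/
theorem valueFn_succ_le (hδ : 0 ≤ δ) (hG : MeasurableSet G) (hR : MeasurableSet R)
    {x₁ : M₁.X} {x₂ : M₂.X}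
    (hW : ∀ u, IsLifting δ R (M₁.T (x₁, u)) (M₂.trans x₂ (U (u, x₁, x₂))) (W (u, x₁, x₂)))
    (n t : ℕ) :
    ENNReal.ofReal (valueFn M₁ δ G μ (n + 1) t x₁) ≤
      ∫⁻ u, ∫⁻ x', trackingPayoff μ W₀ W δ G R n (UM.mk (((t + 1, x₁, x₂), u), x'))
        ∂(M₂.trans x₂ (U (u, x₁, x₂))) ∂(μ.map t (UM.mk x₁)) := by
  have hf := (UnitValued.valueFn (δ := δ) hG μ n (t + 1)).reachPayoff hG
  refine hf.ofReal_trunc_integral_sub_le (M₁.trans x₁ (μ.map t (UM.mk x₁))) hδ ?_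
  have hT : Measurable fun a => M₁.T (x₁, a) := M₁.T.measurable.comp measurable_prodMk_left
  have hb : ∫⁻ x, ENNReal.ofReal (reachPayoff G (valueFn M₁ δ G μ n (t + 1)) x)
      ∂(M₁.trans x₁ (μ.map t (UM.mk x₁))) =
      ∫⁻ u, ∫⁻ x, ENNReal.ofReal (reachPayoff G (valueFn M₁ δ G μ n (t + 1)) x)
        ∂(M₁.T (x₁, u)) ∂(μ.map t (UM.mk x₁)) :=
    Measure.lintegral_bind hT.aemeasurable (UM.aemeasurable_comp_mk hf.measurable_ofReal
      (M₁.trans x₁ (μ.map t (UM.mk x₁))))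
  rw [hb]
  calc _ ≤ ∫⁻ u, (∫⁻ x', trackingPayoff μ W₀ W δ G R n (UM.mk (((t + 1, x₁, x₂), u), x'))
        ∂(M₂.trans x₂ (U (u, x₁, x₂))) + ENNReal.ofReal δ) ∂(μ.map t (UM.mk x₁)) := by
        refine lintegral_mono fun u => ((hW u).lintegral_le hR hf).trans
          (add_le_add (le_of_eq ?_) le_rfl)
        -- The counter `t + 1` is nonzero, so the coupling is `W`, and the transition law of `M₂` is
        -- its second marginal.
        exact (lintegral_trackingKernel W₀ W ((t + 1, x₁, x₂), u)
          (measurable_relPayoff μ hG hR n) (hW u).map_snd).symm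
    _ = _ := by
        rw [lintegral_add_right _ measurable_const, lintegral_const, measure_univ, mul_one]

end TrackingStrategy

/-! ### The robust probabilities are achieved. -/

variable {Y : Type v} [MetricSpace Y] [MeasurableSpace Y] {M₁ M₂ : GMDP.{u, v} Y}

/-- A single strategy for `M₂` achieves the robust probabilities of all horizons. -/
theorem StochasticallySimulated.exists_strategy {ε δ : ℝ} (hδ : 0 ≤ δ)
    (h : StochasticallySimulated ε δ M₁ M₂) (μ : MarkovPolicy M₁) {K Kε : Set Y}
    (hK : MeasurableSet K) (hKε : MeasurableSet Kε) (hsub : Kε ⊆ erosion ε K) :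
    ∃ C : ControlStrategy M₂, ∀ N,
      robustProbWithin M₁ δ (M₁.h ⁻¹' Kε) μ N ≤ C.probReachWithin N K := by
  obtain ⟨U, _, R, hR, W, _, hdist, hW, W₀, hW₀⟩ := h
  have := hW₀.prob
  obtain ⟨x₁⟩ := M₁.nonempty_X
  obtain ⟨x₂⟩ := M₂.nonempty_X
  obtain ⟨a⟩ := nonempty_of_isProbabilityMeasure (μ.map 0 (UM.mk x₁))
  set G : Set M₁.X := M₁.h ⁻¹' Kε
  have hG : MeasurableSet G := M₁.measurable_h hKε
  -- The only use of the erosion: outputs related by `R` are ε-close, so x₁ ∈ G forces the output of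
  -- `M₂` into `K`.
  have hGK : ∀ y ∈ R, M₂.h y.2 ∉ K → y.1 ∉ G := fun y hy hyK hyG =>
    hyK (hsub hyG _ (by rw [dist_comm]; exact hdist y.1 y.2 hy))
  set C := trackingStrategy μ U W₀ W x₁ x₂ a
  set g := trackingPayoff μ W₀ W δ G R
  have hgm : ∀ n, Measurable (g n) := measurable_trackingPayoff μ W₀ W hG hR
  have hg1 : ∀ n z, g n z ≤ 1 := fun n z =>
    (lintegral_mono (relPayoff_le_one μ hG n)).trans (by simp)
  have hg0 : ∀ z : UM (C.XC × M₂.X), M₂.h z.get.2 ∉ K → g 0 z = 0 := by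
    intro z hz
    refine (trackingPayoff_eq μ W₀ W hG hR 0 z).trans ?_
    exact lintegral_eq_zero_of_ae_eq_zero (Eventually.of_forall fun x => le_zero_iff.1
      (relPayoff_le μ (fun h => hGK _ h hz) fun _ => by simp [valueFn]))
  have hgs : ∀ n, ∀ z : UM (C.XC × M₂.X), M₂.h z.get.2 ∉ K →
      g (n + 1) z ≤ ∫⁻ y, g n y ∂(UM.complete C.step z) := by
    intro n z hz
    refine le_of_le_of_eq ?_
      (lintegral_trackingStrategy_step μ U W₀ W x₁ x₂ a z (hgm n)).symm
    refine (trackingPayoff_eq μ W₀ W hG hR (n + 1) z).le.trans (lintegral_mono fun x => ?_)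
    -- The comparison is made for each posterior draw `x` separately; the lifting property is needed
    -- only when the pair is in `R`.
    refine relPayoff_le μ (fun h => hGK _ h hz) fun hxR => ?_
    exact valueFn_succ_le μ U W₀ W hδ hG hR (hW x z.get.2 hxR) n _
  refine ⟨C, fun N => ?_⟩
  have hprob := C.lintegral_le_probReachWithin hK hgm hg1 hg0 hgs N
  have hf := (UnitValued.valueFn (δ := δ) hG μ N 0).reachPayoff hG
  have hinit : ∫⁻ x, g N (UM.mk (C.init, x)) ∂M₂.init = _ :=
    lintegral_trackingKernel W₀ W ((0, x₁, x₂), a) (measurable_relPayoff μ hG hR N) hW₀.map_snd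
  refine (ENNReal.ofReal_le_ofReal_iff measureReal_nonneg).1 (le_trans ?_ (hinit.ge.trans hprob))
  exact hf.ofReal_trunc_integral_sub_le M₁.init hδ (hW₀.lintegral_le hR hf)

end

theorem corollary2 {Y : Type v} [MetricSpace Y] [MeasurableSpace Y] [BorelSpace Y]
    (M₁ : GMDP.{u, v} Y) (μ : MarkovPolicy M₁) (ε δ : ℝ) (hε : 0 ≤ ε) (hδ : 0 ≤ δ)
    (K : Set Y) (hK : MeasurableSet K)
    (Kε : Set Y) (hKε : MeasurableSet Kε) (hsub : Kε ⊆ erosion ε K) :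
    (∀ N : ℕ, RobustlyReachesWithin ε δ M₁ μ N K
      (robustProbWithin M₁ δ (M₁.h ⁻¹' Kε) μ N)) ∧
    (μ.IsTimeHomogeneous →
      (∀ x, Tendsto (fun q : ℕ => (robustOp M₁ δ (M₁.h ⁻¹' Kε) (μ.map 0))^[q] 0 x) atTop
        (𝓝 (limitValueFn M₁ δ (M₁.h ⁻¹' Kε) (μ.map 0) x))) ∧
      robustOp M₁ δ (M₁.h ⁻¹' Kε) (μ.map 0) (limitValueFn M₁ δ (M₁.h ⁻¹' Kε) (μ.map 0)) =
        limitValueFn M₁ δ (M₁.h ⁻¹' Kε) (μ.map 0) ∧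
      RobustlyReaches ε δ M₁ μ K (robustProb M₁ δ (M₁.h ⁻¹' Kε) (μ.map 0))) := by
  have hG : MeasurableSet (M₁.h ⁻¹' Kε) := M₁.measurable_h hKε
  refine ⟨fun N M₂ h => ?_, fun hμ => ⟨tendsto_iterate_robustOp hG, robustOp_limitValueFn hG,
    fun M₂ h => ?_⟩⟩
  · obtain ⟨C, hC⟩ := h.exists_strategy hδ μ hK hKε hsub
    exact ⟨C, hC N⟩
  · obtain ⟨C, hC⟩ := h.exists_strategy hδ μ hK hKε hsub
    -- For a time-homogeneous policy the finite-horizon values are the iterates, and each is bounded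
    -- by the probability that the same `C` ever reaches `K`.
    refine ⟨C, le_of_tendsto' (tendsto_initialValue_iterate hG) fun N => ?_⟩
    rw [← hμ.valueFn_eq N 0]
    exact (hC N).trans (C.probReachWithin_le_probReach N K)
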